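/- Let $t\ge 0$ be an integer and let $G$ be a finite simple graph with minimum degree at least $7t+7$ (in particular, $G$ has at least one vertex). Then $G$ contains the complete graph $K_t$ as an immersion. That is, there are an injective map $\pi_1:V(K_t)\to V(G)$ and a map $\pi_2$ assigning to each edge $e=xy$ of $K_t$ a path $\pi_2(e)$ in $G$ with endpoints $\pi_1(x)$ and $\pi_1(y)$, such that for any two distinct edges $e\neq e'$ of $K_t$ the paths $\pi_2(e)$ and $\pi_2(e')$ have no edge in common. -/

import Mathlib

/-- An immersion of the graph `H` in the graph `G`: an injection `branch` of the vertices of `H`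
into those of `G`, and for every edge `e = xy` of `H` a path `path e` of `G` whose two endpoints
are `branch x` and `branch y` (in either order), such that the paths of distinct edges have no
edge in common. Paths may share vertices, and may pass through branch vertices. -/
structure GraphImmersion {W V : Type*} (H : SimpleGraph W) (G : SimpleGraph V) where
  branch : W ↪ V
  source : H.edgeSet → V
  target : H.edgeSet → V
  path : ∀ e : H.edgeSet, G.Path (source e) (target e)
  endpoints : ∀ e : H.edgeSet, s(source e, target e) = Sym2.map branch (e : Sym2 W)
  edge_disjoint : ∀ e e' : H.edgeSet, e ≠ e' →
    ∀ a : Sym2 V, a ∈ (path e : G.Walk (source e) (target e)).edges →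
      a ∉ (path e' : G.Walk (source e') (target e')).edges

/-- `G` contains `H` as an immersion. -/
def ContainsImmersion {V W : Type*} (G : SimpleGraph V) (H : SimpleGraph W) : Prop :=
  Nonempty (GraphImmersion H G)

/-!
# Clique immersions from minimum degree `7 * t + 7`

The proof is an induction on the number of vertices, by splitting off vertices: deleting `z` and
joining its neighbours in pairs keeps all other degrees, and the result is immersed in the old
graph, as long as the pairs are non-adjacent. The induction runs over graphs in which one vertex may
have degree `7 * t + 6` (`NearlyMinDegree`), and it starts from this vertex, `v`.

If the non-edges inside the neighbourhood of `z` have no (nearly) perfect matching, then the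
Tutte-Berge theorem makes the neighbourhood look like a complete multipartite graph. As there is
neither a `t`-clique nor a `K_{t,t}` (both contain the immersion), all but fewer than `t` vertices lie
in one part, and the rest is a set `B` of near-twins of `z`, each missing at most `|B|` neighbours of
`z` (`exists_nonadjPairing_or_near_complete`). Splitting off `z` would cost the vertices of `B` some
degree, so they are to be removed as well. In this way a cluster grows around `v`
(`ClusterState`). What its vertices miss is counted in a set `Ws` of common potential neighbours,
inside the neighbourhood of `v`: splitting off cluster vertices never removes adjacencies to
`Ws`, so a vertex still to be split off misses no more vertices of `Ws` than the cluster has members.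
A vertex gains at most one edge for each cluster vertex, whence members of the cluster miss few
vertices of `Ws` in the original graph, too. Once there are `t` members, any two have so many common
neighbours that they can be joined greedily by edge-disjoint paths of length two
(`hasCliqueImmersion_of_commonNeighbors`, `ClusterState.extend`). So the cluster stays smaller than
`t`, and the process ends with the whole cluster split off.

Parity needs care: if the number of outside neighbours of `z` is odd, one of them, `y`, stays
unpaired. It is served through an edge `zp` inside the cluster: the path `y, z, p, c` becomes an edge
`yc` for a suitable neighbour `c` of `p` (`shortcut`), and `c` is dropped from `Ws`. If no `c` is
suitable, `y` is itself a near-twin of `p` and joins the cluster. Only the last vertex of the cluster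
has no `p`; its `y` becomes the exceptional vertex of the smaller graph.
-/

universe u

/-! ### Immersions and sources of clique immersions -/

section Immersion

variable {U V W : Type*}

/-- The graph `H` is immersed in `G` with branch map `x`: each edge `ab` of `H` owns a set
`F s(a, b)` of edges, the sets of distinct edges are disjoint, and `x a` is joined to `x b` by
edges of `G` that `ab` owns. The branch map need not be injective here. -/
def ImmersesVia (x : W → V) (H : SimpleGraph W) (G : SimpleGraph V) : Prop :=
  ∃ F : Sym2 W → Set (Sym2 V),
    (∀ a b, H.Adj a b → (G ⊓ SimpleGraph.fromEdgeSet (F s(a, b))).Reachable (x a) (x b)) ∧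
    ∀ e ∈ H.edgeSet, ∀ e' ∈ H.edgeSet, e ≠ e' → Disjoint (F e) (F e')

theorem ImmersesVia.refl (G : SimpleGraph V) : ImmersesVia id G G := by
  refine ⟨fun e => {e}, fun a b h => ?_, fun e _ e' _ h => by simpa using h⟩
  exact SimpleGraph.Adj.reachable (by simp [h, h.ne])

theorem ImmersesVia.trans {x : W → V} {y : V → U} {H : SimpleGraph W} {G : SimpleGraph V}
    {K : SimpleGraph U} (h₁ : ImmersesVia x H G) (h₂ : ImmersesVia y G K) :
    ImmersesVia (y ∘ x) H K := by
  obtain ⟨F₁, hr₁, hd₁⟩ := h₁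
  obtain ⟨F₂, hr₂, hd₂⟩ := h₂
  refine ⟨fun e => ⋃ f ∈ F₁ e ∩ G.edgeSet, F₂ f, fun a b hab => ?_, fun e he e' he' hne => ?_⟩
  · obtain ⟨p⟩ := hr₁ a b hab
    simp only [Function.comp]
    generalize x a = u, x b = v at p
    induction p with
    | nil => exact SimpleGraph.Reachable.refl _
    | @cons u v w huv p ih =>
      refine SimpleGraph.Reachable.trans ?_ ih
      simp only [SimpleGraph.inf_adj, SimpleGraph.fromEdgeSet_adj] at huv
      refine (hr₂ u v huv.1).mono (inf_le_inf_left _ (SimpleGraph.fromEdgeSet_mono ?_))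
      exact Set.subset_biUnion_of_mem (u := F₂) (show s(u, v) ∈ F₁ s(a, b) ∩ G.edgeSet from
        ⟨huv.2.1, huv.1⟩)
  · simp only [Set.disjoint_iUnion_left, Set.disjoint_iUnion_right]
    intro f hf f' hf'
    refine hd₂ _ hf'.2 _ hf.2 ?_
    rintro rfl
    exact Set.disjoint_left.1 (hd₁ e he e' he' hne) hf'.1 hf.1

/-- `G` contains an immersion of the complete graph on `t` vertices. -/
def HasCliqueImmersion (t : ℕ) (G : SimpleGraph V) : Prop :=
  ∃ x : Fin t → V, Function.Injective x ∧ ImmersesVia x (⊤ : SimpleGraph (Fin t)) G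

theorem HasCliqueImmersion.of_immersesVia {t : ℕ} {G' G : SimpleGraph V}
    (h : HasCliqueImmersion t G') (hG : ImmersesVia id G' G) : HasCliqueImmersion t G := by
  obtain ⟨x, hx, h⟩ := h
  exact ⟨x, hx, h.trans hG⟩

theorem ImmersesVia.containsImmersion {x : W → V} {H : SimpleGraph W} {G : SimpleGraph V}
    (hx : Function.Injective x) (h : ImmersesVia x H G) : ContainsImmersion G H := by
  classical
  obtain ⟨F, hr, hd⟩ := h
  have key : ∀ e : H.edgeSet, ∃ (a b : V) (p : G.Path a b),
      s(a, b) = Sym2.map x (e : Sym2 W) ∧ ∀ f ∈ (p : G.Walk a b).edges, f ∈ F e := by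
    rintro ⟨e, he⟩
    induction e using Sym2.ind with
    | _ a b =>
      obtain ⟨p, hp⟩ := (hr a b he).exists_isPath
      have hle : G ⊓ SimpleGraph.fromEdgeSet (F s(a, b)) ≤ G := inf_le_left
      refine ⟨x a, x b, ⟨p.mapLe hle, (SimpleGraph.Walk.isPath_mapLe hle).2 hp⟩, rfl, ?_⟩
      intro f hf
      simp only [SimpleGraph.Walk.edges_mapLe_eq_edges] at hf
      have := p.edges_subset_edgeSet hf
      simp only [SimpleGraph.edgeSet_inf, SimpleGraph.edgeSet_fromEdgeSet] at this
      exact this.2.1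
  choose a b p hab hF using key
  exact ⟨⟨⟨x, hx⟩, a, b, p, hab, fun e e' hne f hf hf' =>
    Set.disjoint_left.1 (hd e e.2 e' e'.2 fun h => hne (Subtype.ext h)) (hF e f hf) (hF e' f hf')⟩⟩

theorem hasCliqueImmersion_of_isClique {t : ℕ} {G : SimpleGraph V} {x : Fin t → V}
    (hx : Function.Injective x) (h : ∀ i j, i ≠ j → G.Adj (x i) (x j)) :
    HasCliqueImmersion t G := by
  refine ⟨x, hx, fun e => {Sym2.map x e}, fun i j hij => ?_, fun e _ e' _ hne => ?_⟩
  · exact SimpleGraph.Adj.reachable (by simp [h i j hij, hx.ne hij])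
  · simpa using fun h => hne (Sym2.map.injective hx h)

/-- Branch vertices may be joined by paths of length two through middle vertices `c i j`, as long
as the middle vertices used at a fixed branch vertex are distinct. -/
theorem hasCliqueImmersion_of_middle {t : ℕ} {G : SimpleGraph V} {x : Fin t → V}
    (hx : Function.Injective x) (c : Fin t → Fin t → V)
    (hsymm : ∀ i j, c i j = c j i) (hadj : ∀ i j, i ≠ j → G.Adj (x i) (c i j))
    (hdisj : ∀ i j k, i ≠ j → c i j ≠ x k)
    (hinj : ∀ i j k, i ≠ j → i ≠ k → c i j = c i k → j = k) :
    HasCliqueImmersion t G := by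
  refine ⟨x, hx, fun e => {f | ∃ i j, i ≠ j ∧ s(i, j) = e ∧ f = s(x i, c i j)},
    fun i j hij => ?_, fun e _ e' _ hne => ?_⟩
  · have h1 := hadj i j hij
    have h2 := hadj j i hij.symm
    rw [← hsymm] at h2
    refine (SimpleGraph.Adj.reachable (v := c i j) ?_).trans (SimpleGraph.Adj.reachable ?_)
    · simp only [SimpleGraph.inf_adj, SimpleGraph.fromEdgeSet_adj]
      exact ⟨h1, ⟨i, j, hij, rfl, rfl⟩, h1.ne⟩
    · simp only [SimpleGraph.inf_adj, SimpleGraph.fromEdgeSet_adj]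
      exact ⟨h2.symm, ⟨j, i, hij.symm, Sym2.eq_swap, by rw [Sym2.eq_swap, hsymm]⟩, h2.ne'⟩
  · rw [Set.disjoint_left]
    rintro f ⟨i, j, hij, rfl, rfl⟩ ⟨i', j', hij', rfl, h⟩
    apply hne
    rw [Sym2.eq_iff] at h
    rcases h with ⟨h1, h2⟩ | ⟨h1, h2⟩
    · obtain rfl := hx h1
      rw [hinj i j j' hij hij' h2]
    · exact (hdisj i' j' i hij' h1.symm).elim

theorem hasCliqueImmersion_of_biclique {t : ℕ} {G : SimpleGraph V} {P Q : Finset V}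
    (hP : t ≤ P.card) (hQ : t ≤ Q.card) (hPQ : Disjoint P Q)
    (h : ∀ a ∈ P, ∀ b ∈ Q, G.Adj a b) : HasCliqueImmersion t G := by
  classical
  obtain ⟨P', hP', hcP⟩ := Finset.exists_subset_card_eq hP
  obtain ⟨Q', hQ', hcQ⟩ := Finset.exists_subset_card_eq hQ
  let x := (P'.equivFinOfCardEq hcP).symm
  let y := (Q'.equivFinOfCardEq hcQ).symm
  refine hasCliqueImmersion_of_middle (x := fun i => (x i : V)) (fun i j hij => x.injective (Subtype.ext hij))
    -- the addition table of `ℤ/t` is a proper edge colouring of the complete graph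
    (fun i j => (y (i + j) : V)) (fun i j => by rw [add_comm])
    (fun i j _ => h _ (hP' (x i).2) _ (hQ' (y _).2)) (fun i j k _ he => ?_) (fun i j k _ _ he => ?_)
  · exact Finset.disjoint_left.1 hPQ (hP' (x k).2) (he ▸ hQ' (y (i + j)).2)
  · have : NeZero t := ⟨by rintro rfl; exact i.elim0⟩
    exact add_left_cancel (y.injective (Subtype.ext he))

/-- Greedy choice from lists: if the items are handled in order of increasing rank `f` and each list
is larger than the number of conflicting items handled before, then conflicts can be avoided. -/
theorem exists_choice_of_card_conflict_lt {ι C : Type*} [DecidableEq ι] [DecidableEq C] [Nonempty C]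
    (f : ι → ℕ)
    (L : ι → Finset C) (r : ι → ι → Prop) [DecidableRel r] (hr : ∀ a b, r a b → r b a) (S : Finset ι)
    (h : ∀ a ∈ S, (S.filter fun b => b ≠ a ∧ f b ≤ f a ∧ r a b).card < (L a).card) :
    ∃ c : ι → C, (∀ a ∈ S, c a ∈ L a) ∧ ∀ a ∈ S, ∀ b ∈ S, a ≠ b → r a b → c a ≠ c b := by
  induction S using Finset.induction_on_max_value f with
  | empty => exact ⟨fun _ => Classical.arbitrary C, by simp⟩
  | insert a S ha hmax ih =>
    obtain ⟨c, hc, hcr⟩ := ih fun b hb => (Finset.card_le_card (Finset.filter_subset_filter _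
      (Finset.subset_insert _ _))).trans_lt (h b (Finset.mem_insert_of_mem hb))
    have hlt := h a (Finset.mem_insert_self _ _)
    obtain ⟨k, hk, hk'⟩ : ∃ k ∈ L a, k ∉ (S.filter fun b => r a b).image c := by
      by_contra! hcon
      have h1 := (Finset.card_le_card (fun k hk => hcon k hk)).trans Finset.card_image_le
      have h2 : (S.filter fun b => r a b) ⊆
          (insert a S).filter fun b => b ≠ a ∧ f b ≤ f a ∧ r a b := by
        intro b hb
        simp only [Finset.mem_filter] at hb
        simp only [Finset.mem_filter, Finset.mem_insert]
        exact ⟨Or.inr hb.1, fun h => ha (h ▸ hb.1), hmax b hb.1, hb.2⟩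
      have := Finset.card_le_card h2
      omega
    simp only [Finset.mem_image, Finset.mem_filter, not_exists, not_and, and_imp] at hk'
    have hup : ∀ b ∈ S, Function.update c a k b = c b := fun b hb =>
      Function.update_of_ne (fun hba : b = a => ha (hba ▸ hb)) _ _
    refine ⟨Function.update c a k, fun b hb => ?_, fun b hb b' hb' hne hrb => ?_⟩
    · rcases Finset.mem_insert.1 hb with rfl | hbS
      · simpa using hk
      · rw [hup b hbS]
        exact hc b hbS
    · rcases Finset.mem_insert.1 hb with rfl | hbS <;> rcases Finset.mem_insert.1 hb' with rfl | hbS'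
      · exact (hne rfl).elim
      · rw [Function.update_self, hup b' hbS']
        exact fun h => hk' b' hbS' hrb h.symm
      · rw [Function.update_self, hup b hbS]
        exact hk' b hbS (hr _ _ hrb)
      · rw [hup b hbS, hup b' hbS']
        exact hcr b hbS b' hbS' hne hrb

/-- Greedy clique immersion. If the pairs of branch vertices `x i`, `x j` are joined through common
neighbours in order of decreasing `i + j`, at most `2 * t - 3 - i - j` candidates are blocked when
the pair `i, j` is reached. So pairs with large indices need fewer common neighbours. -/
theorem hasCliqueImmersion_of_commonNeighbors {t : ℕ} {G : SimpleGraph V} [DecidableRel G.Adj]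
    {x : Fin t → V} (hx : Function.Injective x) (W : Finset V) (hW : ∀ i, x i ∉ W)
    (h : ∀ i j : Fin t, i < j →
      2 * t ≤ (W.filter fun w => G.Adj (x i) w ∧ G.Adj (x j) w).card + i + j + 2) :
    HasCliqueImmersion t G := by
  classical
  rcases Nat.eq_zero_or_pos t with rfl | ht
  · exact hasCliqueImmersion_of_isClique hx fun i => i.elim0
  have : Nonempty V := ⟨x ⟨0, ht⟩⟩
  let L : Fin t × Fin t → Finset V := fun a => W.filter fun w => G.Adj (x a.1) w ∧ G.Adj (x a.2) w
  let r : Fin t × Fin t → Fin t × Fin t → Prop := fun a b =>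
    a.1 = b.1 ∨ a.1 = b.2 ∨ a.2 = b.1 ∨ a.2 = b.2
  obtain ⟨c, hcL, hcr⟩ := exists_choice_of_card_conflict_lt
    (fun a : Fin t × Fin t => 2 * t - a.1 - a.2) L r (by
      rintro a b (h | h | h | h) <;> simp [r, h]) (Finset.univ.filter fun a => a.1 < a.2) (by
      rintro ⟨i, j⟩ hij
      simp only [Finset.mem_filter, Finset.mem_univ, true_and] at hij
      have hL : 2 * t ≤ (L (i, j)).card + i + j + 2 := h i j hij
      refine lt_of_le_of_lt (Finset.card_le_card (t := (Finset.Ioi j).image (fun k => (i, k)) ∪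
        ((Finset.Ioi i).erase j).image (fun k => if k < j then (k, j) else (j, k))) ?_) ?_
      · rintro ⟨k, l⟩ hkl
        simp only [Finset.mem_filter, Finset.mem_univ, true_and, r, ne_eq, Prod.mk.injEq] at hkl
        simp only [Finset.mem_union, Finset.mem_image, Finset.mem_Ioi, Finset.mem_erase,
          Prod.mk.injEq]
        obtain ⟨hkl, hne, hf, hr⟩ := hkl
        have e1 := i.2
        have e2 := j.2
        have e3 := k.2
        have e4 := l.2
        by_cases hik : i = k
        · subst hik
          left
          refine ⟨l, ?_, rfl, rfl⟩
          have : (l : ℕ) ≠ j := fun h => hne ⟨rfl, Fin.ext h⟩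
          rw [Fin.lt_def]
          omega
        · right
          have hik' : (i : ℕ) ≠ k := fun h => hik (Fin.ext h)
          rw [Fin.lt_def] at hkl hij
          by_cases hjk : j = k
          · subst hjk
            exact ⟨l, ⟨by rintro rfl; omega, by rw [Fin.lt_def]; omega⟩,
              by rw [if_neg (by rw [Fin.lt_def]; omega)]⟩
          · have hjk' : (j : ℕ) ≠ k := fun h => hjk (Fin.ext h)
            have hjl : j = l := by
              rcases hr with h | h | h | h
              · exact (hik h).elim
              · have := congrArg Fin.val h
                omega
              · exact (hjk h).elim
              · exact h
            subst hjl
            exact ⟨k, ⟨by rintro rfl; omega, by rw [Fin.lt_def]; omega⟩,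
              by rw [if_pos (by rw [Fin.lt_def]; omega)]⟩
      · refine lt_of_le_of_lt ((Finset.card_union_le _ _).trans
          (add_le_add Finset.card_image_le Finset.card_image_le)) ?_
        rw [Finset.card_erase_of_mem (Finset.mem_Ioi.2 hij), Fin.card_Ioi, Fin.card_Ioi]
        rw [Fin.lt_def] at hij
        have e2 := j.2
        omega)
  have hc : ∀ i j, i < j → c (i, j) ∈ W ∧ G.Adj (x i) (c (i, j)) ∧ G.Adj (x j) (c (i, j)) := by
    intro i j hij
    simpa [L] using hcL (i, j) (by simpa using hij)
  have hcr' : ∀ i j k l, i < j → k < l → (i = k ∨ i = l ∨ j = k ∨ j = l) →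
      c (i, j) = c (k, l) → i = k ∧ j = l := by
    intro i j k l hij hkl hr he
    by_contra hne
    exact hcr (i, j) (by simpa using hij) (k, l) (by simpa using hkl) (by simpa using hne) hr he
  refine hasCliqueImmersion_of_middle hx (fun i j => if i < j then c (i, j) else c (j, i))
    (fun i j => ?_) (fun i j hij => ?_) (fun i j k hij he => ?_) (fun i j k hij hik he => ?_)
  · rcases lt_trichotomy i j with h | rfl | h
    · simp [h, h.le]
    · rfl
    · simp [h, h.le]
  · rcases lt_or_gt_of_ne hij with h | h
    · simpa [h] using (hc i j h).2.1
    · simpa [h, h.not_gt] using (hc j i h).2.2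
  · rcases lt_or_gt_of_ne hij with h | h
    · exact hW k (he ▸ by simpa [h] using (hc i j h).1)
    · exact hW k (he ▸ by simpa [h, h.not_gt] using (hc j i h).1)
  · rcases lt_or_gt_of_ne hij with h | h <;> rcases lt_or_gt_of_ne hik with h' | h' <;>
      simp only [h, h', h.not_gt, h'.not_gt, if_true, if_false] at he
    · exact (hcr' _ _ _ _ h h' (by simp) he).2
    · obtain ⟨h1, h2⟩ := hcr' _ _ _ _ h h' (by simp) he
      exact h2.trans h1
    · obtain ⟨h1, h2⟩ := hcr' _ _ _ _ h h' (by simp) he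
      exact h1.trans h2
    · exact (hcr' _ _ _ _ h h' (by simp) he).1

end Immersion

/-! ### Splitting off, and the Tutte-Berge theorem -/

section Splitting

variable {V : Type*}

/-- `m` pairs the vertices of `A` into non-adjacent pairs: a perfect matching of the complement of
`G` on `A`. Values of `m` outside `A` are irrelevant. -/
structure IsNonadjPairing (G : SimpleGraph V) (A : Finset V) (m : V → V) : Prop where
  mem : ∀ a ∈ A, m a ∈ A
  invol : ∀ a ∈ A, m (m a) = a
  ne : ∀ a ∈ A, m a ≠ a
  not_adj : ∀ a ∈ A, ¬ G.Adj a (m a)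

/-- Delete all edges at `z` and join each `a ∈ A` to its partner `m a`: every path `a, z, m a`
is split off. -/
def splitOff (G : SimpleGraph V) (z : V) (A : Finset V) (m : V → V) : SimpleGraph V where
  Adj a b := (G.Adj a b ∧ a ≠ z ∧ b ≠ z) ∨ (a ∈ A ∧ b ∈ A ∧ m a = b ∧ m b = a ∧ a ≠ b)
  symm := ⟨fun a b h => by
    rcases h with ⟨h, h1, h2⟩ | ⟨h1, h2, h3, h4, h5⟩
    · exact Or.inl ⟨h.symm, h2, h1⟩
    · exact Or.inr ⟨h2, h1, h4, h3, h5.symm⟩⟩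
  loopless := ⟨fun a h => by
    rcases h with ⟨h, -⟩ | ⟨-, -, -, -, h⟩
    · exact h.ne rfl
    · exact h rfl⟩

theorem splitOff_adj {G : SimpleGraph V} {z : V} {A : Finset V} {m : V → V} {a b : V} :
    (splitOff G z A m).Adj a b ↔
      (G.Adj a b ∧ a ≠ z ∧ b ≠ z) ∨ (a ∈ A ∧ b ∈ A ∧ m a = b ∧ m b = a ∧ a ≠ b) := Iff.rfl

theorem supp_splitOff {G : SimpleGraph V} {z : V} {A U R : Finset V} {m : V → V}
    (hA : ∀ a ∈ A, G.Adj z a) (supp : ∀ a b, G.Adj a b → a ∈ U ∧ a ∉ R) [DecidableEq V] {a b : V}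
    (h : (splitOff G z A m).Adj a b) : a ∈ U ∧ a ∉ insert z R := by
  rw [Finset.mem_insert, not_or]
  rcases h with ⟨h1, h2, -⟩ | ⟨h1, -⟩
  · exact ⟨(supp a b h1).1, h2, (supp a b h1).2⟩
  · have h2 := supp a z (hA a h1).symm
    exact ⟨h2.1, (hA a h1).ne', h2.2⟩

theorem splitOff_immersesVia {G : SimpleGraph V} {z : V} {A : Finset V} {m : V → V}
    (hA : ∀ a ∈ A, G.Adj z a) : ImmersesVia id (splitOff G z A m) G := by
  classical
  refine ⟨fun e => if e ∈ G.edgeSet then {e} else {f | ∃ a ∈ e, f = s(a, z)}, fun a b h => ?_, ?_⟩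
  · by_cases hG : G.Adj a b
    · exact SimpleGraph.Adj.reachable (by simp [hG, hG.ne])
    · rcases h with ⟨h, -⟩ | ⟨ha, hb, -⟩
      · exact (hG h).elim
      · have h1 := hA a ha
        have h2 := hA b hb
        refine (SimpleGraph.Adj.reachable (v := z) ?_).trans (SimpleGraph.Adj.reachable ?_)
        · simp [hG, h1.symm, h1.ne']
        · simp [hG, h2, h2.ne]
  · intro e he e' he' hne
    induction e using Sym2.ind with
    | _ a b =>
    induction e' using Sym2.ind with
    | _ a' b' =>
    simp only [SimpleGraph.mem_edgeSet, splitOff_adj] at he he' ⊢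
    by_cases h : G.Adj a b <;> by_cases h' : G.Adj a' b' <;>
      simp only [h, h', true_and, false_and, false_or, if_true, if_false] at he he' ⊢
    · simpa using hne
    · rw [Set.disjoint_singleton_left]
      rintro ⟨x, hx, hxz⟩
      rcases Sym2.eq_iff.1 hxz with ⟨-, rfl⟩ | ⟨rfl, -⟩ <;> grind
    · rw [Set.disjoint_singleton_right]
      rintro ⟨x, hx, hxz⟩
      rcases Sym2.eq_iff.1 hxz with ⟨-, rfl⟩ | ⟨rfl, -⟩ <;> grind
    · rw [Set.disjoint_left]
      rintro f ⟨x, hx, rfl⟩ ⟨x', hx', hxx⟩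
      obtain rfl : x = x' := by rwa [Sym2.congr_left] at hxx
      apply hne
      rw [Sym2.mem_iff] at hx hx'
      grind

/-- Replace the path `y, z, p, c` by the edge `yc`. -/
def shortcut (G : SimpleGraph V) (y z p c : V) : SimpleGraph V where
  Adj a b := (G.Adj a b ∧ s(a, b) ≠ s(y, z) ∧ s(a, b) ≠ s(z, p) ∧ s(a, b) ≠ s(p, c)) ∨
    (s(a, b) = s(y, c) ∧ a ≠ b)
  symm := ⟨fun _ b h => by rwa [Sym2.eq_swap (a := b), G.adj_comm, ne_comm (a := b)]⟩
  loopless := ⟨fun _ h => by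
    rcases h with ⟨h, -⟩ | ⟨-, h⟩
    · exact h.ne rfl
    · exact h rfl⟩

theorem shortcut_adj {G : SimpleGraph V} {y z p c a b : V} : (shortcut G y z p c).Adj a b ↔
    (G.Adj a b ∧ s(a, b) ≠ s(y, z) ∧ s(a, b) ≠ s(z, p) ∧ s(a, b) ≠ s(p, c)) ∨
    (s(a, b) = s(y, c) ∧ a ≠ b) := Iff.rfl

theorem shortcut_immersesVia {G : SimpleGraph V} {y z p c : V} (hyz : G.Adj y z) (hzp : G.Adj z p)
    (hpc : G.Adj p c) : ImmersesVia id (shortcut G y z p c) G := by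
  classical
  refine ⟨fun e => if e = s(y, c) then {s(y, z), s(z, p), s(p, c)} else {e}, fun a b h => ?_, ?_⟩
  · by_cases hab : s(a, b) = s(y, c)
    · have key : (G ⊓ SimpleGraph.fromEdgeSet {s(y, z), s(z, p), s(p, c)}).Reachable y c := by
        refine (SimpleGraph.Adj.reachable (v := z) ?_).trans
          ((SimpleGraph.Adj.reachable (v := p) ?_).trans (SimpleGraph.Adj.reachable ?_))
        · simp [hyz, hyz.ne]
        · simp [hzp, hzp.ne]
        · simp [hpc, hpc.ne]
      simp only [hab, if_true, id]
      rcases Sym2.eq_iff.1 hab with ⟨rfl, rfl⟩ | ⟨rfl, rfl⟩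
      · exact key
      · exact key.symm
    · rcases h with ⟨h, -⟩ | ⟨h, -⟩
      · exact SimpleGraph.Adj.reachable (by simp [hab, h, h.ne])
      · exact (hab h).elim
  · intro e he e' he' hne
    induction e using Sym2.ind with
    | _ a b =>
    induction e' using Sym2.ind with
    | _ a' b' =>
    simp only [SimpleGraph.mem_edgeSet, shortcut] at he he' 
    by_cases h : s(a, b) = s(y, c) <;> by_cases h' : s(a', b') = s(y, c)
    · exact (hne (h.trans h'.symm)).elim
    · simp only [h, h', if_true, if_false, false_and, or_false] at he he' ⊢
      simpa [-Sym2.eq, eq_comm] using he'.2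
    · simp only [h, h', if_true, if_false, false_and, or_false] at he he' ⊢
      simpa [-Sym2.eq] using he.2
    · simpa [h, h'] using hne

section Tutte

variable {α : Type*} [Finite α]

/-- In a graph of even order the surplus of a Tutte violator is even, hence at least two. -/
theorem ncard_add_two_le_of_isTutteViolator {H : SimpleGraph α} (hα : Even (Nat.card α)) {T : Set α}
    (hT : H.IsTutteViolator T) :
    T.ncard + 2 ≤ ((⊤ : H.Subgraph).deleteVerts T).coe.oddComponents.ncard := by
  have h1 := SimpleGraph.odd_ncard_oddComponents ((⊤ : H.Subgraph).deleteVerts T).coe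
  have h2 : Nat.card ((⊤ : H.Subgraph).deleteVerts T).verts + T.ncard = Nat.card α := by
    have : ((⊤ : H.Subgraph).deleteVerts T).verts = Tᶜ := by ext; simp
    rw [this, Nat.card_coe_set_eq, add_comm, Set.ncard_add_ncard_compl]
  unfold SimpleGraph.IsTutteViolator at hT
  by_contra hcon
  have h3 : ((⊤ : H.Subgraph).deleteVerts T).coe.oddComponents.ncard = T.ncard + 1 := by omega
  rw [h3, Nat.odd_iff] at h1
  rw [Nat.odd_iff] at h1
  rw [Nat.even_iff] at hα
  omega

/-- A labelling constant on the components of `H - T`, with at least as many values outside `T` as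
`H - T` has odd components. -/
theorem exists_labelling (H : SimpleGraph α) (T : Set α) :
    ∃ κ : α → Option ((⊤ : H.Subgraph).deleteVerts T).coe.ConnectedComponent,
      (∀ a b, a ∉ T → b ∉ T → H.Adj a b → κ a = κ b) ∧
      ((⊤ : H.Subgraph).deleteVerts T).coe.oddComponents.ncard ≤ (κ '' Tᶜ).ncard := by
  classical
  have hv : ∀ a, a ∉ T → a ∈ ((⊤ : H.Subgraph).deleteVerts T).verts := by simp
  refine ⟨fun a => if h : a ∉ T then some (SimpleGraph.connectedComponentMk _ ⟨a, hv a h⟩) else none,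
    fun a b ha hb hab => ?_, ?_⟩
  · simp only [ha, hb, not_false_eq_true, dif_pos, Option.some.injEq, SimpleGraph.ConnectedComponent.eq]
    exact SimpleGraph.Adj.reachable (by simp [ha, hb, hab])
  · rw [← Set.ncard_image_of_injective _ (Option.some_injective _)]
    refine Set.ncard_le_ncard ?_ (Set.toFinite _)
    rintro _ ⟨c, -, rfl⟩
    induction c using SimpleGraph.ConnectedComponent.ind with
    | _ v =>
      obtain ⟨v, hv'⟩ := v
      have hvT : v ∉ T := by simpa using hv'
      exact ⟨v, hvT, by simp [hvT]⟩

/-- `H` with a new vertex `none` joined to all others. -/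
def addUniversal (H : SimpleGraph α) : SimpleGraph (Option α) where
  Adj a b := a ≠ b ∧ ∀ x ∈ a, ∀ y ∈ b, H.Adj x y
  symm := ⟨fun _ _ h => ⟨h.1.symm, fun x hx y hy => (h.2 y hy x hx).symm⟩⟩
  loopless := ⟨fun _ h => h.1 rfl⟩

/-- The Tutte-Berge theorem for deficiency at most one: either some matching misses at most one
vertex, or there is a set `T` and a labelling constant on the components of `H - T` that takes at
least `|T| + 2` values outside `T`. (The parity of the components is not recorded.) -/
theorem exists_pairing_or_labelling {α : Type u} [Finite α] (H : SimpleGraph α) :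
    (∃ m : α → α, ∀ a, m (m a) = a ∧ H.Adj a (m a)) ∨
    (∃ (y : α) (m : α → α), ∀ a, a ≠ y → m a ≠ y ∧ m (m a) = a ∧ H.Adj a (m a)) ∨
    ∃ (T : Set α) (C : Type u) (κ : α → C), (∀ a b, a ∉ T → b ∉ T → H.Adj a b → κ a = κ b) ∧
      T.ncard + 2 ≤ (κ '' Tᶜ).ncard := by
  classical
  rcases Nat.even_or_odd (Nat.card α) with hα | hα
  · by_cases hM : ∃ M : H.Subgraph, M.IsPerfectMatching
    · obtain ⟨M, hM⟩ := hM
      rw [SimpleGraph.Subgraph.isPerfectMatching_iff] at hM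
      choose m hm hu using hM
      exact Or.inl ⟨m, fun a => ⟨(hu _ _ (hm a).symm).symm, (hm a).adj_sub⟩⟩
    · rw [SimpleGraph.tutte] at hM
      push Not at hM
      obtain ⟨T, hT⟩ := hM
      obtain ⟨κ, hκ, hc⟩ := exists_labelling H T
      exact Or.inr (Or.inr ⟨T, _, κ, hκ, (ncard_add_two_le_of_isTutteViolator hα hT).trans hc⟩)
  · right
    have hα' : Even (Nat.card (Option α)) := by
      rw [Finite.card_option]
      exact hα.add_one
    have hsome : ∀ a b, (addUniversal H).Adj (some a) (some b) ↔ H.Adj a b := by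
      intro a b
      simp only [addUniversal, ne_eq, Option.some.injEq, Option.mem_def, forall_eq']
      exact ⟨fun h => h.2, fun h => ⟨h.ne, h⟩⟩
    by_cases hM : ∃ M : (addUniversal H).Subgraph, M.IsPerfectMatching
    · left
      obtain ⟨M, hM⟩ := hM
      rw [SimpleGraph.Subgraph.isPerfectMatching_iff] at hM
      choose m hm hu using hM
      have hinv : ∀ a, m (m a) = a := fun a => (hu _ _ (hm a).symm).symm
      obtain ⟨y, hy⟩ : ∃ y, m none = some y := Option.ne_none_iff_exists'.1 (hm none).adj_sub.ne'
      refine ⟨y, fun a => (m (some a)).getD a, fun a ha => ?_⟩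
      obtain ⟨b, hb⟩ : ∃ b, m (some a) = some b := by
        refine Option.ne_none_iff_exists'.1 fun h => ha ?_
        have := hinv (some a)
        rw [h, hy] at this
        exact (Option.some_injective _ this).symm
      have hba := hinv (some a)
      rw [hb] at hba
      refine ⟨?_, by simp [hb, hba], by simpa [hb, hsome] using (hm (some a)).adj_sub⟩
      rintro h
      simp only [hb, Option.getD_some] at h
      have := hinv none
      rw [hy, ← h, hba] at this
      simp at this
    · right
      rw [SimpleGraph.tutte] at hM
      push Not at hM
      obtain ⟨T, hT⟩ := hM
      have h2 := ncard_add_two_le_of_isTutteViolator hα' hT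
      obtain ⟨κ, hκ, hc⟩ := exists_labelling (addUniversal H) T
      -- a vertex joined to everything must lie in `T`, or else there is only one component
      have hnone : none ∈ T := by
        by_contra hn
        have : κ '' Tᶜ ⊆ {κ none} := by
          rintro _ ⟨a, ha, rfl⟩
          by_cases han : a = none
          · simp [han]
          · exact hκ _ _ ha hn ⟨han, by simp⟩
        have := Set.ncard_le_ncard this
        rw [Set.ncard_singleton] at this
        omega
      refine ⟨some ⁻¹' T, _, fun a => κ (some a), fun a b ha hb hab => hκ _ _ ha hb ((hsome a b).2 hab),
        ?_⟩
      have e1 : T = insert none (some '' (some ⁻¹' T)) := by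
        ext a
        cases a <;> simp [hnone]
      have e2 : (some ⁻¹' T).ncard ≤ T.ncard := by
        conv_rhs => rw [e1, Set.ncard_insert_of_notMem (by simp),
          Set.ncard_image_of_injective _ (Option.some_injective _)]
        omega
      have e3 : κ '' Tᶜ ⊆ (fun a => κ (some a)) '' (some ⁻¹' T)ᶜ := by
        rintro _ ⟨a, ha, rfl⟩
        cases a with
        | none => exact (ha hnone).elim
        | some a => exact ⟨a, ha, rfl⟩
      have := Set.ncard_le_ncard e3
      omega

end Tutte

end Splitting

/-! ### Pairing non-adjacent vertices -/

section Pairing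

open Classical in
/-- Suppose the labels of the vertices of `N \ T` are such that vertices with distinct labels are
adjacent. Without a clique immersion, there are fewer than `t` labels, and all but fewer than `t`
vertices carry the same label; the exceptional ones form `B`. A vertex of `B` can only be
non-adjacent to `T` and to its own label class, and there are enough labels for `B` to be at least
as large as these two together. -/
theorem exists_near_complete_of_labelling {V C : Type*} [DecidableEq C] {J : SimpleGraph V} {N T : Finset V} {t : ℕ}
    (hJ : ¬ HasCliqueImmersion t J) (hN : 4 * t ≤ N.card) (hT : T ⊆ N) (κ : V → C)
    (hκ : ∀ a ∈ N \ T, ∀ b ∈ N \ T, κ a ≠ κ b → J.Adj a b)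
    (hc : T.card + 2 ≤ ((N \ T).image κ).card) :
    ∃ B ⊆ N, B.Nonempty ∧ B.card < t ∧ ∀ b ∈ B, (N.filter fun w => ¬ J.Adj b w).card ≤ B.card := by
  set Y := N \ T with hY
  have hct : (Y.image κ).card < t := by
    by_contra! hcon
    obtain ⟨S, hS, hSc⟩ := Finset.exists_subset_card_eq hcon
    have hrep : ∀ c : S, ∃ a ∈ Y, κ a = c := fun c => Finset.mem_image.1 (hS c.2)
    choose f hfY hfκ using hrep
    let e := (S.equivFinOfCardEq hSc).symm
    have hne : ∀ i j, i ≠ j → κ (f (e i)) ≠ κ (f (e j)) := fun i j hij h => hij <| by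
      rw [hfκ, hfκ] at h
      exact e.injective (Subtype.ext h)
    exact hJ (hasCliqueImmersion_of_isClique (x := fun i => f (e i))
      (fun i j h => by_contra fun hij => hne i j hij (congrArg κ h))
      (fun i j hij => hκ _ (hfY _) _ (hfY _) (hne i j hij)))
  have hYc : Y.card + T.card = N.card := Finset.card_sdiff_add_card_eq_card hT
  have hbi : ∀ (p : C → Prop) [DecidablePred p], ¬ (t ≤ (Y.filter fun a => p (κ a)).card ∧
      t ≤ (Y.filter fun a => ¬ p (κ a)).card) := by
    rintro p _ ⟨h1, h2⟩
    refine hJ (hasCliqueImmersion_of_biclique h1 h2 (Finset.disjoint_filter_filter_not _ _ _) ?_)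
    intro a ha b hb
    rw [Finset.mem_filter] at ha hb
    exact hκ a ha.1 b hb.1 fun h => hb.2 (h ▸ ha.2)
  have hsplit : ∀ (p : C → Prop) [DecidablePred p], (Y.filter fun a => p (κ a)).card +
      (Y.filter fun a => ¬ p (κ a)).card = Y.card := fun p _ => Finset.card_filter_add_card_filter_not _
  obtain ⟨c₀, hc₀⟩ : ∃ c₀, (Y.filter fun a => κ a ≠ c₀).card < t := by
    by_cases hbig : ∃ c₀, t ≤ (Y.filter fun a => κ a = c₀).card
    · obtain ⟨c₀, hc₀⟩ := hbig
      refine ⟨c₀, ?_⟩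
      by_contra hcon
      exact hbi (· = c₀) ⟨hc₀, not_lt.1 hcon⟩
    · -- a minimal union of classes with at least `t` vertices has fewer than `2 * t`
      exfalso
      push Not at hbig
      obtain ⟨S, hS, hmin⟩ := Finset.exists_min_image
        ((Y.image κ).powerset.filter fun S : Finset C => t ≤ (Y.filter fun a => κ a ∈ S).card)
        Finset.card ⟨Y.image κ, by
          rw [Finset.mem_filter]
          refine ⟨Finset.mem_powerset_self _, ?_⟩
          rw [Finset.filter_true_of_mem fun a ha => Finset.mem_image_of_mem κ ha]
          omega⟩
      rw [Finset.mem_filter, Finset.mem_powerset] at hS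
      have hSne : S.Nonempty := by
        rw [Finset.nonempty_iff_ne_empty]
        rintro rfl
        simp at hS
        omega
      obtain ⟨c, hc⟩ := hSne
      have h1 : (Y.filter fun a => κ a ∈ S.erase c).card < t := by
        by_contra! hcon
        have := hmin (S.erase c) (by
          rw [Finset.mem_filter, Finset.mem_powerset]
          exact ⟨(Finset.erase_subset _ _).trans hS.1, hcon⟩)
        have := Finset.card_erase_lt_of_mem hc
        omega
      have h2 : (Y.filter fun a => κ a ∈ S) ⊆
          (Y.filter fun a => κ a ∈ S.erase c) ∪
            Y.filter fun a => κ a = c := by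
        intro a
        simp only [Finset.mem_filter, Finset.mem_union, Finset.mem_erase]
        tauto
      have h3 := (Finset.card_le_card h2).trans (Finset.card_union_le _ _)
      have h4 := hbig c
      have h5 := hsplit (· ∈ S)
      exact hbi (· ∈ S) ⟨hS.2, by omega⟩
  refine ⟨Y.filter fun a => κ a ≠ c₀, (Finset.filter_subset _ _).trans Finset.sdiff_subset, ?_, hc₀,
    fun b hb => ?_⟩
  · obtain ⟨c, hc, hne⟩ := Finset.exists_mem_ne (s := Y.image κ) (by omega) c₀
    obtain ⟨a, ha, rfl⟩ := Finset.mem_image.1 hc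
    exact ⟨a, Finset.mem_filter.2 ⟨ha, hne⟩⟩
  · rw [Finset.mem_filter] at hb
    have h1 : (N.filter fun w => ¬ J.Adj b w) ⊆ T ∪ Y.filter fun a => κ a = κ b := by
      intro w hw
      rw [Finset.mem_filter] at hw
      rw [Finset.mem_union, Finset.mem_filter]
      by_cases hwT : w ∈ T
      · exact Or.inl hwT
      · have hwY : w ∈ Y := Finset.mem_sdiff.2 ⟨hw.1, hwT⟩
        exact Or.inr ⟨hwY, by_contra fun h => hw.2 (hκ b hb.1 w hwY (Ne.symm h))⟩
    have h2 : (Y.image κ) ⊆ {c₀, κ b} ∪ (Y.filter fun a => κ a ≠ c₀ ∧ κ a ≠ κ b).image κ := by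
      intro c hc
      obtain ⟨a, ha, rfl⟩ := Finset.mem_image.1 hc
      simp only [Finset.mem_union, Finset.mem_insert, Finset.mem_singleton, Finset.mem_image,
        Finset.mem_filter]
      by_cases h : κ a = c₀ ∨ κ a = κ b
      · exact Or.inl h
      · exact Or.inr ⟨a, ⟨ha, not_or.1 h⟩, rfl⟩
    have h3 : (Y.filter fun a => κ a = κ b).card + (Y.filter fun a => κ a ≠ c₀ ∧ κ a ≠ κ b).card
        ≤ (Y.filter fun a => κ a ≠ c₀).card := by
      rw [← Finset.card_union_of_disjoint]
      · refine Finset.card_le_card fun a => ?_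
        simp only [Finset.mem_union, Finset.mem_filter]
        rintro (⟨h, h'⟩ | ⟨h, h'⟩)
        · exact ⟨h, h' ▸ hb.2⟩
        · exact ⟨h, h'.1⟩
      · rw [Finset.disjoint_filter]
        tauto
    have h4 := (Finset.card_le_card h1).trans (Finset.card_union_le _ _)
    have h5 := (Finset.card_le_card h2).trans (Finset.card_union_le _ _)
    have h6 := Finset.card_le_two (a := c₀) (b := κ b)
    have h7 := Finset.card_image_le (s := Y.filter fun a => κ a ≠ c₀ ∧ κ a ≠ κ b) (f := κ)
    omega

open Classical in
/-- In a large vertex set of a graph without clique immersion, the non-edges have a perfect or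
nearly perfect matching, or there is a small set `B` of vertices adjacent to almost everything,
each missing no more than `|B|` vertices. -/
theorem exists_nonadjPairing_or_near_complete {V : Type u} {J : SimpleGraph V}
    {N : Finset V} {t : ℕ} (hJ : ¬ HasCliqueImmersion t J) (hN : 4 * t ≤ N.card) :
    (∃ m, IsNonadjPairing J N m) ∨ (∃ y ∈ N, ∃ m, IsNonadjPairing J (N.erase y) m) ∨
    ∃ B ⊆ N, B.Nonempty ∧ B.card < t ∧ ∀ b ∈ B, (N.filter fun w => ¬ J.Adj b w).card ≤ B.card := by
  let H : SimpleGraph N := (J.comap Subtype.val)ᶜ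
  have hH : ∀ a b : N, H.Adj a b ↔ a ≠ b ∧ ¬ J.Adj a b := fun a b => by simp [H]
  rcases exists_pairing_or_labelling H with ⟨m, hm⟩ | ⟨y, m, hm⟩ | ⟨T, C, κ, hκ, hc⟩
  · refine Or.inl ⟨fun a => if h : a ∈ N then m ⟨a, h⟩ else a, ?_⟩
    constructor <;> intro a ha <;> obtain ⟨h1, h2⟩ := hm ⟨a, ha⟩ <;> rw [hH] at h2 <;>
      simp only [ha, dif_pos, (m ⟨a, ha⟩).2, h1, Subtype.coe_eta]
    · exact fun h => h2.1 (Subtype.ext h.symm)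
    · exact h2.2
  · refine Or.inr (Or.inl ⟨y, y.2, fun a => if h : a ∈ N then m ⟨a, h⟩ else a, ?_⟩)
    constructor <;> intro a ha <;> obtain ⟨hay, ha⟩ := Finset.mem_erase.1 ha <;>
      obtain ⟨h0, h1, h2⟩ := hm ⟨a, ha⟩ (fun h => hay (congrArg Subtype.val h)) <;>
      rw [hH] at h2 <;>
      simp only [ha, dif_pos, (m ⟨a, ha⟩).2, h1, Subtype.coe_eta, Finset.mem_erase, and_true]
    · exact fun h => h0 (Subtype.ext h)
    · exact fun h => h2.1 (Subtype.ext h.symm)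
    · exact h2.2
  · refine Or.inr (Or.inr ?_)
    have hTc : (T.toFinset.map (Function.Embedding.subtype _)).card = T.ncard := by
      rw [Finset.card_map, Set.ncard_eq_toFinset_card']
    have hmem : ∀ a : N, (a : V) ∈ N \ T.toFinset.map (Function.Embedding.subtype _) ↔ a ∉ T := by
      intro a
      simp
    refine exists_near_complete_of_labelling hJ hN
      (T := T.toFinset.map (Function.Embedding.subtype _)) ?_
      (fun a => if h : a ∈ N then some (κ ⟨a, h⟩) else none) ?_ ?_
    · intro a ha
      obtain ⟨b, -, rfl⟩ := Finset.mem_map.1 ha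
      exact b.2
    · intro a ha b hb hab
      have haN := (Finset.mem_sdiff.1 ha).1
      have hbN := (Finset.mem_sdiff.1 hb).1
      have ha' := (hmem ⟨a, haN⟩).1 ha
      have hb' := (hmem ⟨b, hbN⟩).1 hb
      by_contra hadj
      simp only [haN, hbN, dif_pos, ne_eq, Option.some.injEq] at hab
      exact hab (hκ _ _ ha' hb' ((hH _ _).2 ⟨fun h => hab (by rw [h]), hadj⟩))
    · rw [hTc]
      refine hc.trans ?_
      rw [← Set.ncard_image_of_injective _ (Option.some_injective _), ← Set.ncard_coe_finset]
      refine Set.ncard_le_ncard ?_ (Set.toFinite _)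
      rintro _ ⟨_, ⟨a, ha, rfl⟩, rfl⟩
      exact Finset.mem_coe.2 (Finset.mem_image.2 ⟨a, (hmem a).2 ha, by simp⟩)

end Pairing

/-! ### Clusters of near-twins -/

section Cluster

variable {V : Type u}

open Classical in
/-- The vertices of `W` that are not adjacent to `a`. -/
noncomputable def nonNbrs (G : SimpleGraph V) (W : Finset V) (a : V) : Finset V :=
  W.filter fun w => ¬ G.Adj a w

@[simp] theorem mem_nonNbrs {G : SimpleGraph V} {W : Finset V} {a b : V} :
    b ∈ nonNbrs G W a ↔ b ∈ W ∧ ¬ G.Adj a b := by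
  simp [nonNbrs]

open Classical in
/-- Numbering the vertices of `B` after those of `X`. -/
theorem exists_index_extension {X B : Finset V} (hXB : Disjoint X B) {n : ℕ} (idx : V → ℕ)
    (hlt : ∀ x ∈ X, idx x < n) (hinj : ∀ x ∈ X, ∀ y ∈ X, idx x = idx y → x = y) :
    ∃ idx' : V → ℕ, (∀ x ∈ X, idx' x = idx x) ∧ (∀ x ∈ B, n ≤ idx' x) ∧
      (∀ x ∈ X ∪ B, idx' x < n + B.card) ∧
      ∀ x ∈ X ∪ B, ∀ y ∈ X ∪ B, idx' x = idx' y → x = y := by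
  have hB : ∀ x ∈ B, x ∉ X := fun x hx hx' => Finset.disjoint_left.1 hXB hx' hx
  refine ⟨fun a => if h : a ∈ B then n + B.equivFin ⟨a, h⟩ else idx a, fun x hx => ?_, fun x hx => ?_,
    fun x hx => ?_, fun x hx y hy h => ?_⟩
  · exact dif_neg fun h => hB x h hx
  · simp [hx]
  · by_cases h : x ∈ B
    · simp [h]
    · have := hlt x ((Finset.mem_union.1 hx).resolve_right h)
      simp only [h, dif_neg, not_false_eq_true]
      omega
  · by_cases h1 : x ∈ B <;> by_cases h2 : y ∈ B <;>
      simp only [h1, h2, dif_pos, dif_neg, not_false_eq_true] at h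
    · have h3 := B.equivFin.injective (Fin.ext (Nat.add_left_cancel h))
      exact congrArg Subtype.val h3
    · have := hlt y ((Finset.mem_union.1 hy).resolve_right h2)
      omega
    · have := hlt x ((Finset.mem_union.1 hx).resolve_right h1)
      omega
    · exact hinj x ((Finset.mem_union.1 hx).resolve_right h1) y
        ((Finset.mem_union.1 hy).resolve_right h2) h

/-- Every vertex of the list, except the last, is adjacent to a later one. -/
def Attached (G : SimpleGraph V) : List V → Prop
  | [] => True
  | z :: l => (l = [] ∨ ∃ p ∈ l, G.Adj z p) ∧ Attached G l

theorem Attached.mono {G G' : SimpleGraph V} {l : List V} (h : Attached G l)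
    (hG : ∀ a ∈ l, ∀ b ∈ l, G.Adj a b → G'.Adj a b) : Attached G' l := by
  induction l with
  | nil => trivial
  | cons z l ih =>
    refine ⟨h.1.imp_right ?_, ih h.2 fun a ha b hb =>
      hG a (List.mem_cons_of_mem _ ha) b (List.mem_cons_of_mem _ hb)⟩
    rintro ⟨p, hp, hzp⟩
    exact ⟨p, hp, hG _ List.mem_cons_self _ (List.mem_cons_of_mem _ hp) hzp⟩

theorem Attached.append {G : SimpleGraph V} {l k : List V} (hl : Attached G l)
    (hk : ∀ b ∈ k, ∃ p ∈ l, G.Adj b p) : Attached G (k ++ l) := by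
  induction k with
  | nil => exact hl
  | cons z k ih =>
    refine ⟨Or.inr ?_, ih fun b hb => hk b (List.mem_cons_of_mem _ hb)⟩
    obtain ⟨p, hp, hzp⟩ := hk z List.mem_cons_self
    exact ⟨p, List.mem_append_right _ hp, hzp⟩

variable [Fintype V]

open Classical in
/-- The neighbours of `a`, as a finset that does not depend on a decidability instance. -/
noncomputable def nbrs (G : SimpleGraph V) (a : V) : Finset V := Finset.univ.filter (G.Adj a)

@[simp] theorem mem_nbrs {G : SimpleGraph V} {a b : V} : b ∈ nbrs G a ↔ G.Adj a b := by
  simp [nbrs]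

/-- The part of a cluster state that survives rerouting a path through the cluster.

`G` is the original graph, with edges inside `U`, and `Gs` is the graph immersed in it that is left
when the cluster vertices in `R` have been split off; those in `Z` are still to be split off. Outside
the cluster `R ∪ Z` all degrees are as in `G`, and all edges of `G` are kept. `Ws` is a set of
vertices outside the cluster, and `idx` numbers the cluster from `0` in order of arrival, such that
the vertex number `i` is non-adjacent in `G` to at most `t + i` vertices of `Ws`. -/
structure PreClusterState (t : ℕ) (G : SimpleGraph V) (U : Finset V) (v : V) (Gs : SimpleGraph V)
    (R : Finset V) (Z : List V) (Ws : Finset V) (idx : V → ℕ) : Prop where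
  immerses : ImmersesVia id Gs G
  supp : ∀ a b, Gs.Adj a b → a ∈ U ∧ a ∉ R
  nodup : Z.Nodup
  disj : ∀ z ∈ Z, z ∉ R
  root : v ∈ R ∨ v ∈ Z
  keep : ∀ a b, a ∉ R → a ∉ Z → b ∉ R → b ∉ Z → G.Adj a b → Gs.Adj a b
  deg : ∀ a, a ∉ R → a ∉ Z → (nbrs Gs a).card = (nbrs G a).card
  mem_Ws : ∀ w ∈ Ws, w ∈ U ∧ w ∉ R ∧ w ∉ Z
  size : R.card + Z.length < t
  idx_lt : ∀ x, x ∈ R ∨ x ∈ Z → idx x < R.card + Z.length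
  idx_inj : ∀ x y, x ∈ R ∨ x ∈ Z → y ∈ R ∨ y ∈ Z → idx x = idx y → x = y
  idx_err : ∀ x, x ∈ R ∨ x ∈ Z → (nonNbrs G Ws x).card ≤ t + idx x

/-- A cluster in the making. In addition to `PreClusterState`, each vertex of `Z` is adjacent to a later
one (so that removing the head of the list leaves the rest connected), `Ws` is large, and no vertex of
`Z` is non-adjacent in `Gs` to more vertices of `Ws` than the cluster has. -/
structure ClusterState (t : ℕ) (G : SimpleGraph V) (U : Finset V) (v : V) (Gs : SimpleGraph V)
    (R : Finset V) (Z : List V) (Ws : Finset V) (idx : V → ℕ) : Prop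
    extends PreClusterState t G U v Gs R Z Ws idx where
  attached : Attached Gs Z
  card_Ws : 7 * t + 6 ≤ Ws.card + 2 * R.card + Z.length
  err : ∀ z ∈ Z, (nonNbrs Gs Ws z).card ≤ R.card + Z.length

variable {t : ℕ} {G Gs : SimpleGraph V} {U R Ws : Finset V} {v z : V} {Z l : List V} {idx : V → ℕ}

theorem PreClusterState.mem_of_adj (st : PreClusterState t G U v Gs R Z Ws idx) {a b : V}
    (h : Gs.Adj a b) : b ∈ U ∧ b ∉ R := st.supp b a h.symm

open Classical in
/-- A vertex outside the cluster keeps its degree and loses edges only to the cluster, so it has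
gained at most as many neighbours as the cluster has vertices. -/
theorem PreClusterState.card_gain_le (st : PreClusterState t G U v Gs R Z Ws idx) {b : V}
    (hR : b ∉ R) (hZ : b ∉ Z) : (nbrs Gs b \ nbrs G b).card ≤ R.card + Z.length := by
  rw [Finset.card_sdiff_comm (st.deg b hR hZ)]
  have h : nbrs G b \ nbrs Gs b ⊆ R ∪ Z.toFinset := by
    intro a ha
    simp only [Finset.mem_sdiff, mem_nbrs] at ha
    simp only [Finset.mem_union, List.mem_toFinset]
    by_contra hcon
    rw [not_or] at hcon
    exact ha.2 (st.keep b a hR hZ hcon.1 hcon.2 ha.1)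
  exact (Finset.card_le_card h).trans ((Finset.card_union_le _ _).trans
    (add_le_add le_rfl (List.toFinset_card_le _)))

open Classical in
/-- Let `B` consist of vertices outside the cluster that miss at most `|B|` of the vertices of `Ws` to
which `z` is adjacent. Then `B` can join the cluster: if it made the cluster as large as `t`, then `t`
vertices of the enlarged cluster would be branch vertices of a clique immersion. -/
theorem ClusterState.extend (hG : ¬ HasCliqueImmersion t G)
    (st : ClusterState t G U v Gs R Z Ws idx) {B : Finset V} (hBt : B.card < t)
    (hB : ∀ b ∈ B, b ∉ R ∧ b ∉ Z) (hadj : ∀ b ∈ B, ∃ p ∈ Z, Gs.Adj b p) (hz : z ∈ Z)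
    (hmiss : ∀ b ∈ B, (nonNbrs Gs (Ws.filter (Gs.Adj z)) b).card ≤ B.card) :
    R.card + (B.toList ++ Z).length < t ∧
      ∃ idx', ClusterState t G U v Gs R (B.toList ++ Z) (Ws \ B) idx' := by
  have hZc : Z.toFinset.card = Z.length := List.toFinset_card_of_nodup st.nodup
  set X := R ∪ Z.toFinset with hX
  have hXmem : ∀ x, x ∈ X ↔ x ∈ R ∨ x ∈ Z := fun x => by simp [hX]
  have hXc : X.card = R.card + Z.length := by
    rw [hX, Finset.card_union_of_disjoint, hZc]
    exact Finset.disjoint_left.2 fun a ha ha' => st.disj a (List.mem_toFinset.1 ha') ha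
  have hn := st.size
  have hW := st.card_Ws
  have herr := st.err z hz
  set n := R.card + Z.length with hndef
  have hidx : ∀ B' ⊆ B, Disjoint X B' := fun B' hB' => Finset.disjoint_left.2 fun a ha ha' => by
    have := hB a (hB' ha')
    rw [hXmem] at ha
    tauto
  have hsub : ∀ b ∈ B, nonNbrs G Ws b ⊆
      nonNbrs Gs Ws z ∪ (nonNbrs Gs (Ws.filter (Gs.Adj z)) b ∪ (nbrs Gs b \ nbrs G b)) := by
    intro b _ w
    simp only [mem_nonNbrs, Finset.mem_union, Finset.mem_filter, Finset.mem_sdiff, mem_nbrs]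
    tauto
  have hgain : ∀ b ∈ B, (nbrs Gs b \ nbrs G b).card ≤ n :=
    fun b hb => st.card_gain_le (hB b hb).1 (hB b hb).2
  have hmissG : ∀ b ∈ B, (nonNbrs G Ws b).card ≤ 2 * n + B.card := by
    intro b hb
    have h1 := (Finset.card_le_card (hsub b hb)).trans (Finset.card_union_le _ _)
    have h2 := Finset.card_union_le (nonNbrs Gs (Ws.filter (Gs.Adj z)) b) (nbrs Gs b \ nbrs G b)
    have h3 := hgain b hb
    have h4 := hmiss b hb
    omega
  have hXerr : ∀ x ∈ X, (nonNbrs G Ws x).card ≤ t + idx x := fun x hx =>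
    st.idx_err x ((hXmem x).1 hx)
  have hsmall : n + B.card < t := by
    by_contra! hcon
    -- only as many vertices of `B` are used as are needed to reach `t` branch vertices
    obtain ⟨B₀, hB₀, hB₀c⟩ := Finset.exists_subset_card_eq (show t - n ≤ B.card by omega)
    obtain ⟨idx', hX', hB', hlt', hinj'⟩ := exists_index_extension (hidx B₀ hB₀) idx
      (fun x hx => st.idx_lt x ((hXmem x).1 hx))
      (fun x hx y hy => st.idx_inj x y ((hXmem x).1 hx) ((hXmem y).1 hy))
    have hSc : (X ∪ B₀).card = t := by
      rw [Finset.card_union_of_disjoint (hidx B₀ hB₀)]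
      omega
    let f : (X ∪ B₀ : Finset V) → Fin t := fun x => ⟨idx' x, by
      have := hlt' x x.2
      omega⟩
    have hf : Function.Bijective f := by
      rw [Fintype.bijective_iff_injective_and_card]
      refine ⟨fun x y hxy => Subtype.ext (hinj' x x.2 y y.2 (congrArg Fin.val hxy)), ?_⟩
      rw [Fintype.card_coe, hSc, Fintype.card_fin]
    let e := (Equiv.ofBijective f hf).symm
    have he : ∀ i, idx' (e i) = i := fun i =>
      congrArg Fin.val ((Equiv.ofBijective f hf).apply_symm_apply i)
    have hW'c : Ws.card ≤ (Ws \ B₀).card + (t - n) := by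
      have := Finset.le_card_sdiff B₀ Ws
      omega
    apply hG
    refine hasCliqueImmersion_of_commonNeighbors (x := fun i => (e i : V))
      (fun i j h => e.injective (Subtype.ext h)) (Ws \ B₀) (fun i hi => ?_) (fun i j hij => ?_)
    · have h1 := (e i).2
      rw [Finset.mem_sdiff] at hi
      have h2 := st.mem_Ws _ hi.1
      rw [Finset.mem_union, hXmem] at h1
      tauto
    · have hi := he i
      have hj := he j
      have hij' : (i : ℕ) < j := hij
      have hi2 := (e i).2
      have hj2 := (e j).2
      generalize (e i : V) = a at *
      generalize (e j : V) = b at *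
      have hcover : ∀ S : Finset V, nonNbrs G Ws a ∪ nonNbrs G Ws b ⊆ S → (Ws \ B₀).card ≤
          ((Ws \ B₀).filter fun w => G.Adj a w ∧ G.Adj b w).card + S.card := by
        intro S hS
        refine (Finset.card_le_card (t := ((Ws \ B₀).filter fun w => G.Adj a w ∧ G.Adj b w) ∪ S)
          fun w hw => ?_).trans (Finset.card_union_le _ _)
        have := @hS w
        simp only [Finset.mem_union, mem_nonNbrs, Finset.mem_sdiff, Finset.mem_filter] at *
        tauto
      have hcab := hcover _ subset_rfl
      have hcu := Finset.card_union_le (nonNbrs G Ws a) (nonNbrs G Ws b)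
      rcases Finset.mem_union.1 hi2 with haX | haB <;> rcases Finset.mem_union.1 hj2 with hbX | hbB
      · have h1 := hXerr a haX
        have h2 := hXerr b hbX
        have h3 := hX' a haX
        have h4 := hX' b hbX
        omega
      · have h1 := hXerr a haX
        have h2 := hmissG b (hB₀ hbB)
        have h3 := hX' a haX
        have h4 := hB' b hbB
        omega
      · have h3 := hX' b hbX
        have h4 := hB' a haB
        have h5 := st.idx_lt b ((hXmem b).1 hbX)
        omega
      · -- the vertices missed by `z` count only once for the two vertices `a` and `b`
        have h1 := hcover (nonNbrs Gs Ws z ∪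
          ((nonNbrs Gs (Ws.filter (Gs.Adj z)) a ∪ (nbrs Gs a \ nbrs G a)) ∪
          (nonNbrs Gs (Ws.filter (Gs.Adj z)) b ∪ (nbrs Gs b \ nbrs G b)))) (by
            have ha := hsub a (hB₀ haB)
            have hb := hsub b (hB₀ hbB)
            refine Finset.union_subset (ha.trans ?_) (hb.trans ?_)
            · exact Finset.union_subset_union_right Finset.subset_union_left
            · exact Finset.union_subset_union_right Finset.subset_union_right)
        have h2 := Finset.card_union_le (nonNbrs Gs Ws z)
          ((nonNbrs Gs (Ws.filter (Gs.Adj z)) a ∪ (nbrs Gs a \ nbrs G a)) ∪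
          (nonNbrs Gs (Ws.filter (Gs.Adj z)) b ∪ (nbrs Gs b \ nbrs G b)))
        have h3 := Finset.card_union_le
          (nonNbrs Gs (Ws.filter (Gs.Adj z)) a ∪ (nbrs Gs a \ nbrs G a))
          (nonNbrs Gs (Ws.filter (Gs.Adj z)) b ∪ (nbrs Gs b \ nbrs G b))
        have h4 := Finset.card_union_le (nonNbrs Gs (Ws.filter (Gs.Adj z)) a) (nbrs Gs a \ nbrs G a)
        have h5 := Finset.card_union_le (nonNbrs Gs (Ws.filter (Gs.Adj z)) b) (nbrs Gs b \ nbrs G b)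
        have h6 := hgain a (hB₀ haB)
        have h7 := hgain b (hB₀ hbB)
        have h8 := hmiss a (hB₀ haB)
        have h9 := hmiss b (hB₀ hbB)
        have h10 := hB' a haB
        have h11 := hB' b hbB
        omega
  have hlen : (B.toList ++ Z).length = B.card + Z.length := by simp
  refine ⟨by omega, ?_⟩
  obtain ⟨idx', hX', hB', hlt', hinj'⟩ := exists_index_extension (hidx B subset_rfl) idx
    (fun x hx => st.idx_lt x ((hXmem x).1 hx))
    (fun x hx y hy => st.idx_inj x y ((hXmem x).1 hx) ((hXmem y).1 hy))
  have hmem : ∀ x, x ∈ R ∨ x ∈ B.toList ++ Z ↔ x ∈ X ∪ B := by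
    intro x
    simp only [List.mem_append, Finset.mem_toList, Finset.mem_union, hXmem]
    tauto
  have hmono : ∀ H : SimpleGraph V, ∀ x, (nonNbrs H (Ws \ B) x).card ≤ (nonNbrs H Ws x).card :=
    fun H x => Finset.card_le_card fun w => by
      simp only [mem_nonNbrs, Finset.mem_sdiff]
      tauto
  refine ⟨idx', ⟨⟨st.immerses, st.supp, ?_, ?_, ?_, ?_, ?_, ?_, by omega, ?_, ?_, ?_⟩, ?_, ?_, ?_⟩⟩
  · rw [List.nodup_append]
    refine ⟨B.nodup_toList, st.nodup, ?_⟩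
    rintro a ha b hb rfl
    exact (hB a (Finset.mem_toList.1 ha)).2 hb
  · intro a ha
    rcases List.mem_append.1 ha with ha | ha
    · exact (hB a (Finset.mem_toList.1 ha)).1
    · exact st.disj a ha
  · exact st.root.imp_right fun h => List.mem_append_right _ h
  · intro a b ha ha' hb hb'
    exact st.keep a b ha (fun h => ha' (List.mem_append_right _ h)) hb
      (fun h => hb' (List.mem_append_right _ h))
  · intro a ha ha'
    exact st.deg a ha (fun h => ha' (List.mem_append_right _ h))
  · intro w hw
    rw [Finset.mem_sdiff] at hw
    obtain ⟨h1, h2, h3⟩ := st.mem_Ws w hw.1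
    refine ⟨h1, h2, ?_⟩
    rw [List.mem_append, Finset.mem_toList]
    tauto
  · intro x hx
    have := hlt' x ((hmem x).1 hx)
    omega
  · intro x y hx hy
    exact hinj' x ((hmem x).1 hx) y ((hmem y).1 hy)
  · intro x hx
    refine (hmono G x).trans ?_
    rcases Finset.mem_union.1 ((hmem x).1 hx) with hx | hx
    · rw [hX' x hx]
      exact hXerr x hx
    · have h1 := hB' x hx
      have h2 := hmissG x hx
      omega
  · exact st.attached.append fun b hb => hadj b (Finset.mem_toList.1 hb)
  · have := Finset.le_card_sdiff B Ws
    omega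
  · intro x hx
    refine (hmono Gs x).trans ?_
    rcases List.mem_append.1 hx with hx | hx
    · have hxB := Finset.mem_toList.1 hx
      have h0 : nonNbrs Gs Ws x ⊆ nonNbrs Gs Ws z ∪ nonNbrs Gs (Ws.filter (Gs.Adj z)) x := by
        intro w
        simp only [mem_nonNbrs, Finset.mem_union, Finset.mem_filter]
        tauto
      have h1 := (Finset.card_le_card h0).trans (Finset.card_union_le _ _)
      have h2 := hmiss x hxB
      omega
    · have := st.err x hx
      omega

end Cluster

/-! ### Removing the cluster -/

section Removal

variable {V : Type u} [Fintype V] {t : ℕ} {G Gs : SimpleGraph V} {U R Ws : Finset V} {v z : V}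
  {Z l : List V} {idx : V → ℕ}

theorem card_nbrs_splitOff {A : Finset V} {m : V → V} (hm : IsNonadjPairing Gs A m)
    (hA : ∀ a ∈ A, Gs.Adj z a) {a : V} (ha : a ∈ A) :
    (nbrs (splitOff Gs z A m) a).card = (nbrs Gs a).card := by
  classical
  have h1 : nbrs (splitOff Gs z A m) a = insert (m a) ((nbrs Gs a).erase z) := by
    ext b
    simp only [mem_nbrs, splitOff_adj, Finset.mem_insert, Finset.mem_erase]
    have := (hA a ha).ne'
    have h1 := hm.mem a ha
    have h2 := hm.invol a ha
    have h3 := hm.ne a ha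
    constructor
    · rintro (h | h)
      · exact Or.inr ⟨h.2.2, h.1⟩
      · exact Or.inl h.2.2.1.symm
    · rintro (rfl | h)
      · exact Or.inr ⟨ha, h1, rfl, h2, h3.symm⟩
      · exact Or.inl ⟨h.2, this, h.1⟩
  have h2 : m a ∉ (nbrs Gs a).erase z := fun h =>
    hm.not_adj a ha (mem_nbrs.1 (Finset.mem_of_mem_erase h))
  have h3 : z ∈ nbrs Gs a := mem_nbrs.2 (hA a ha).symm
  have h4 := Finset.card_pos.2 ⟨z, h3⟩
  rw [h1, Finset.card_insert_of_notMem h2, Finset.card_erase_of_mem h3]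
  omega

open Classical in
theorem nbrs_splitOff_of_notMem {A : Finset V} {m : V → V} {a : V} (ha : a ∉ A) (haz : a ≠ z) :
    nbrs (splitOff Gs z A m) a = (nbrs Gs a).erase z := by
  ext b
  simp only [mem_nbrs, splitOff_adj, Finset.mem_erase]
  tauto

theorem card_nbrs_splitOff_of_not_adj {A : Finset V} {m : V → V} {a : V} (ha : a ∉ A)
    (haz : a ≠ z) (hadj : ¬ Gs.Adj z a) :
    (nbrs (splitOff Gs z A m) a).card = (nbrs Gs a).card := by
  classical
  rw [nbrs_splitOff_of_notMem ha haz, Finset.erase_eq_of_notMem]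
  exact fun h => hadj (mem_nbrs.1 h).symm

open Classical in
/-- A cluster vertex whose outside neighbours are perfectly paired can be split off. -/
theorem PreClusterState.remove (st : PreClusterState t G U v Gs R (z :: l) Ws idx) {m : V → V}
    (hm : IsNonadjPairing Gs ((nbrs Gs z).filter fun a => a ∉ l) m) :
    PreClusterState t G U v (splitOff Gs z ((nbrs Gs z).filter fun a => a ∉ l) m) (insert z R) l
      Ws idx := by
  set A := (nbrs Gs z).filter fun a => a ∉ l with hAdef
  have hA : ∀ a ∈ A, Gs.Adj z a := fun a ha => mem_nbrs.1 (Finset.mem_filter.1 ha).1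
  have hzR : z ∉ R := st.disj z List.mem_cons_self
  have hzl : z ∉ l := (List.nodup_cons.1 st.nodup).1
  have hmem : ∀ x, x ∈ insert z R ∨ x ∈ l ↔ x ∈ R ∨ x ∈ z :: l := by
    intro x
    rw [Finset.mem_insert, List.mem_cons]
    tauto
  have hcard : (insert z R).card + l.length = R.card + (z :: l).length := by
    rw [Finset.card_insert_of_notMem hzR, List.length_cons]
    omega
  have hout : ∀ x, x ∉ insert z R → x ∉ l → x ≠ z ∧ x ∉ R ∧ x ∉ z :: l := by
    intro x h1 h2
    rw [Finset.mem_insert] at h1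
    rw [List.mem_cons]
    tauto
  refine ⟨(splitOff_immersesVia hA).trans st.immerses, fun a b h => supp_splitOff hA st.supp h,
    (List.nodup_cons.1 st.nodup).2, fun x hx => ?_, (hmem v).2 st.root, ?_, ?_, ?_, ?_, ?_, ?_, ?_⟩
  · rw [Finset.mem_insert, not_or]
    exact ⟨fun h => hzl (h ▸ hx), st.disj x (List.mem_cons_of_mem _ hx)⟩
  · intro a b h1 h2 h3 h4 hab
    obtain ⟨ha1, ha2, ha3⟩ := hout a h1 h2
    obtain ⟨hb1, hb2, hb3⟩ := hout b h3 h4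
    exact Or.inl ⟨st.keep a b ha2 ha3 hb2 hb3 hab, ha1, hb1⟩
  · intro a h1 h2
    obtain ⟨ha1, ha2, ha3⟩ := hout a h1 h2
    rw [← st.deg a ha2 ha3]
    by_cases haz : Gs.Adj z a
    · exact card_nbrs_splitOff hm hA (Finset.mem_filter.2 ⟨mem_nbrs.2 haz, h2⟩)
    · exact card_nbrs_splitOff_of_not_adj (fun h => haz (hA a h)) ha1 haz
  · intro w hw
    obtain ⟨h1, h2, h3⟩ := st.mem_Ws w hw
    rw [List.mem_cons, not_or] at h3
    rw [Finset.mem_insert, not_or]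
    exact ⟨h1, ⟨h3.1, h2⟩, h3.2⟩
  · have := st.size
    omega
  · intro x hx
    have := st.idx_lt x ((hmem x).1 hx)
    omega
  · exact fun x y hx hy => st.idx_inj x y ((hmem x).1 hx) ((hmem y).1 hy)
  · exact fun x hx => st.idx_err x ((hmem x).1 hx)

open Classical in
/-- `PreClusterState.remove`, with the conditions that make the result a full cluster state. One vertex
of `Ws` may have been lost before: the bound on `Ws.card` allows for one loss per removal. -/
theorem ClusterState.of_remove (st : PreClusterState t G U v Gs R (z :: l) Ws idx) {m : V → V}
    (hm : IsNonadjPairing Gs ((nbrs Gs z).filter fun a => a ∉ l) m) (hatt : Attached Gs l)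
    (hcard : 7 * t + 6 ≤ Ws.card + 2 * R.card + l.length + 2)
    (herr : ∀ x ∈ l, (nonNbrs Gs Ws x).card ≤ R.card + l.length + 1) :
    ClusterState t G U v (splitOff Gs z ((nbrs Gs z).filter fun a => a ∉ l) m) (insert z R) l
      Ws idx := by
  have hzR : z ∉ R := st.disj z List.mem_cons_self
  have hzl : z ∉ l := (List.nodup_cons.1 st.nodup).1
  refine ⟨st.remove hm, hatt.mono fun a ha b hb hab => Or.inl ⟨hab, ?_, ?_⟩, ?_, fun x hx => ?_⟩
  · rintro rfl
    exact hzl ha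
  · rintro rfl
    exact hzl hb
  · rw [Finset.card_insert_of_notMem hzR]
    omega
  · rw [Finset.card_insert_of_notMem hzR]
    refine (Finset.card_le_card (t := nonNbrs Gs Ws x) fun w => ?_).trans
      ((herr x hx).trans (by omega))
    simp only [mem_nonNbrs]
    rintro ⟨hw, hxw⟩
    refine ⟨hw, fun h => hxw (Or.inl ⟨h, ?_, ?_⟩)⟩
    · rintro rfl
      exact hzl hx
    · rintro rfl
      exact (st.mem_Ws w hw).2.2 List.mem_cons_self

open Classical in
/-- Replacing a path `y, z, p, c` by an edge `yc`, where `z` and `p` are cluster vertices and `y` and `c`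
are not, costs neither `y` nor `c` any degree. -/
theorem PreClusterState.of_shortcut (st : PreClusterState t G U v Gs R Z Ws idx) {y p c : V}
    (hz : z ∈ Z) (hp : p ∈ Z) (hyZ : y ∉ Z) (hcZ : c ∉ Z) (hyz : Gs.Adj y z) (hzp : Gs.Adj z p)
    (hpc : Gs.Adj p c) (hyc : ¬ Gs.Adj y c) (hne : y ≠ c) :
    PreClusterState t G U v (shortcut Gs y z p c) R Z (Ws.erase c) idx := by
  have hyz' : y ≠ z := hyz.ne
  have hcp : c ≠ p := hpc.ne'
  have hyp : y ≠ p := fun h => hyZ (h ▸ hp)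
  have hcz : c ≠ z := fun h => hcZ (h ▸ hz)
  refine ⟨(shortcut_immersesVia hyz hzp hpc).trans st.immerses, ?_, st.nodup, st.disj, st.root, ?_, ?_,
    fun w hw => st.mem_Ws w (Finset.mem_of_mem_erase hw), st.size, st.idx_lt, st.idx_inj, ?_⟩
  · rintro a b (⟨h, -⟩ | ⟨h, -⟩)
    · exact st.supp a b h
    · rcases Sym2.eq_iff.1 h with ⟨rfl, -⟩ | ⟨rfl, -⟩
      · exact st.supp _ _ hyz
      · exact st.supp _ _ hpc.symm
  · intro a b h1 h2 h3 h4 hab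
    refine Or.inl ⟨st.keep a b h1 h2 h3 h4 hab, ?_, ?_, ?_⟩ <;> intro h <;>
      rcases Sym2.eq_iff.1 h with ⟨rfl, rfl⟩ | ⟨rfl, rfl⟩ <;> contradiction
  · intro a h1 h2
    rw [← st.deg a h1 h2]
    have haz : a ≠ z := fun h => h2 (h ▸ hz)
    have hap : a ≠ p := fun h => h2 (h ▸ hp)
    by_cases hay : a = y
    · subst hay
      have e : nbrs (shortcut Gs a z p c) a = insert c ((nbrs Gs a).erase z) := by
        ext b
        simp only [mem_nbrs, shortcut_adj, Finset.mem_insert, Finset.mem_erase, ne_eq, Sym2.eq_iff]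
        grind
      have h3 : z ∈ nbrs Gs a := mem_nbrs.2 hyz
      have h4 := Finset.card_pos.2 ⟨z, h3⟩
      rw [e, Finset.card_insert_of_notMem (fun h => hyc (mem_nbrs.1 (Finset.mem_of_mem_erase h))),
        Finset.card_erase_of_mem h3]
      omega
    · by_cases hac : a = c
      · subst hac
        have e : nbrs (shortcut Gs y z p a) a = insert y ((nbrs Gs a).erase p) := by
          ext b
          simp only [mem_nbrs, shortcut_adj, Finset.mem_insert, Finset.mem_erase, ne_eq, Sym2.eq_iff]
          grind
        have h3 : p ∈ nbrs Gs a := mem_nbrs.2 hpc.symm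
        have h4 := Finset.card_pos.2 ⟨p, h3⟩
        rw [e, Finset.card_insert_of_notMem
          (fun h => hyc (mem_nbrs.1 (Finset.mem_of_mem_erase h)).symm), Finset.card_erase_of_mem h3]
        omega
      · congr 1
        ext b
        simp only [mem_nbrs, shortcut_adj, ne_eq, Sym2.eq_iff]
        grind
  · intro x hx
    refine (Finset.card_le_card fun w => ?_).trans (st.idx_err x hx)
    simp only [mem_nonNbrs, Finset.mem_erase]
    tauto

/-- The class of graphs on which the induction runs: the edges lie inside `U`, and all vertices of
`U` have degree at least `7 * t + 7`, except for one vertex whose degree may be smaller by one. -/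
def NearlyMinDegree (t : ℕ) (G : SimpleGraph V) (U : Finset V) : Prop :=
  (∀ a b, G.Adj a b → a ∈ U) ∧ ∃ v ∈ U, 7 * t + 6 ≤ (nbrs G v).card ∧
    ∀ u ∈ U, u ≠ v → 7 * t + 7 ≤ (nbrs G u).card

open Classical in
/-- The removal process. Every step either enlarges the cluster or splits off one of its vertices, and
the cluster stays smaller than `t`, so `2 * (t - |R ∪ Z|) + |Z|` decreases. When `Z` has run out, the
remaining graph is smaller and falls under the induction hypothesis `ih`. -/
theorem ClusterState.hasCliqueImmersion (hU : ∀ u ∈ U, u ≠ v → 7 * t + 7 ≤ (nbrs G u).card)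
    (hvU : v ∈ U)
    (ih : ∀ (G' : SimpleGraph V) (U' : Finset V), U' ⊂ U → NearlyMinDegree t G' U' →
      HasCliqueImmersion t G') (k : ℕ) :
    ∀ {Gs : SimpleGraph V} {R : Finset V} {Z : List V} {Ws : Finset V} {idx : V → ℕ},
    ClusterState t G U v Gs R Z Ws idx → 2 * (t - (R.card + Z.length)) + Z.length = k →
    HasCliqueImmersion t G := by
  induction k using Nat.strong_induction_on with
  | _ k ihk =>
  intro Gs R Z Ws idx st hk
  have hsize := st.size
  have hcard := st.card_Ws
  by_contra hG
  have hGs : ¬ HasCliqueImmersion t Gs := fun h => hG (h.of_immersesVia st.immerses)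
  have hext : ∀ (z : V) (B : Finset V), z ∈ Z → B.Nonempty → B.card < t →
      (∀ b ∈ B, b ∉ Z ∧ ∃ p ∈ Z, Gs.Adj b p) →
      (∀ b ∈ B, (nonNbrs Gs (Ws.filter (Gs.Adj z)) b).card ≤ B.card) → False := by
    intro z B hz hBne hBt hB hmiss
    obtain ⟨h1, idx', st'⟩ := st.extend hG hBt (fun b hb => by
      obtain ⟨h1, p, -, hbp⟩ := hB b hb
      exact ⟨(st.supp b p hbp).2, h1⟩) (fun b hb => (hB b hb).2) hz hmiss
    have hpos := hBne.card_pos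
    have hlen : (B.toList ++ Z).length = B.card + Z.length := by simp
    exact hG (ihk _ (by omega) st' rfl)
  cases Z with
  | nil =>
    apply hG
    have hWpos : 0 < Ws.card := by
      simp only [List.length_nil] at hsize hcard
      omega
    obtain ⟨w, hw⟩ := Finset.card_pos.1 hWpos
    have hvR : v ∈ R := st.root.resolve_right List.not_mem_nil
    have hdeg : ∀ u ∈ U \ R, 7 * t + 7 ≤ (nbrs Gs u).card := by
      intro u hu
      rw [Finset.mem_sdiff] at hu
      rw [st.deg u hu.2 List.not_mem_nil]
      exact hU u hu.1 fun h => hu.2 (h ▸ hvR)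
    have hwU : w ∈ U \ R := Finset.mem_sdiff.2 ⟨(st.mem_Ws w hw).1, (st.mem_Ws w hw).2.1⟩
    refine (ih Gs (U \ R) ?_ ⟨fun a b h => Finset.mem_sdiff.2 (st.supp a b h), w, hwU,
      (Nat.le_succ _).trans (hdeg w hwU), fun u hu _ => hdeg u hu⟩).of_immersesVia st.immerses
    exact Finset.ssubset_iff_subset_ne.2 ⟨Finset.sdiff_subset, fun h => by
      rw [← h, Finset.mem_sdiff] at hvU
      exact hvU.2 hvR⟩
  | cons z l =>
    simp only [List.length_cons] at hsize hcard hk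
    have hzl : z ∉ l := (List.nodup_cons.1 st.nodup).1
    have hzR : z ∉ R := st.disj z List.mem_cons_self
    have herr : ∀ x ∈ z :: l, (nonNbrs Gs Ws x).card ≤ R.card + l.length + 1 := st.err
    set A := (nbrs Gs z).filter fun a => a ∉ l with hAdef
    have hA : ∀ a ∈ A, Gs.Adj z a := fun a ha => mem_nbrs.1 (Finset.mem_filter.1 ha).1
    have hAl : ∀ a ∈ A, a ∉ z :: l := fun a ha => by
      rw [List.mem_cons, not_or]
      exact ⟨(hA a ha).ne', (Finset.mem_filter.1 ha).2⟩
    have hWA : ∀ w ∈ Ws, Gs.Adj z w → w ∈ A := by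
      intro w hw hzw
      have := (st.mem_Ws w hw).2.2
      rw [List.mem_cons, not_or] at this
      exact Finset.mem_filter.2 ⟨mem_nbrs.2 hzw, this.2⟩
    have hAcard : 4 * t ≤ A.card := by
      have h1 : Ws ⊆ A ∪ nonNbrs Gs Ws z := by
        intro w hw
        rw [Finset.mem_union, mem_nonNbrs]
        by_cases h : Gs.Adj z w
        · exact Or.inl (hWA w hw h)
        · exact Or.inr ⟨hw, h⟩
      have h2 := (Finset.card_le_card h1).trans (Finset.card_union_le _ _)
      have h3 := herr z List.mem_cons_self
      omega
    rcases exists_nonadjPairing_or_near_complete hGs hAcard with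
      ⟨m, hm⟩ | ⟨y, hy, m, hm⟩ | ⟨B, hBA, hBne, hBt, hB⟩
    · have st' := ClusterState.of_remove st.toPreClusterState hm st.attached.2 (by omega)
        fun x hx => herr x (List.mem_cons_of_mem _ hx)
      have hcR := Finset.card_insert_of_notMem (s := R) hzR
      exact hG (ihk _ (by omega) st' rfl)
    · have hzy := hA y hy
      have hyZ := hAl y hy
      rcases st.attached.1 with rfl | ⟨p, hp, hzp⟩
      · -- `z` is the last vertex of the cluster, and `y` loses one edge
        apply hG
        have hA' : ∀ a ∈ A.erase y, Gs.Adj z a := fun a ha => hA a (Finset.mem_of_mem_erase ha)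
        have hvR : v ∈ insert z R := by
          rw [Finset.mem_insert]
          exact st.root.symm.imp_left List.mem_singleton.1
        have hyU : y ∈ U \ insert z R := by
          have := st.mem_of_adj hzy
          rw [Finset.mem_sdiff, Finset.mem_insert, not_or]
          exact ⟨this.1, hzy.ne', this.2⟩
        have hdeg : ∀ u ∈ U \ insert z R, 7 * t + 7 ≤ (nbrs Gs u).card ∧ u ≠ z := by
          intro u hu
          rw [Finset.mem_sdiff] at hu
          have hu2 := hu.2
          rw [Finset.mem_insert, not_or] at hu2
          rw [st.deg u hu2.2 (by simpa using hu2.1)]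
          exact ⟨hU u hu.1 fun h => hu.2 (h ▸ hvR), hu2.1⟩
        refine (ih (splitOff Gs z (A.erase y) m) (U \ insert z R) ?_ ⟨fun a b h =>
          Finset.mem_sdiff.2 (supp_splitOff hA' st.supp h), y, hyU, ?_, fun u hu huy => ?_⟩
          ).of_immersesVia ((splitOff_immersesVia hA').trans st.immerses)
        · exact Finset.ssubset_iff_subset_ne.2 ⟨Finset.sdiff_subset, fun h => by
            rw [← h, Finset.mem_sdiff] at hvU
            exact hvU.2 hvR⟩
        · rw [nbrs_splitOff_of_notMem (Finset.notMem_erase _ _) hzy.ne']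
          have h1 := (hdeg y hyU).1
          have h2 := Finset.pred_card_le_card_erase (s := nbrs Gs y) (a := z)
          omega
        · have h1 := hdeg u hu
          by_cases hzu : Gs.Adj z u
          · rw [card_nbrs_splitOff hm hA' (Finset.mem_erase.2 ⟨huy, Finset.mem_filter.2
              ⟨mem_nbrs.2 hzu, List.not_mem_nil⟩⟩)]
            exact h1.1
          · rw [card_nbrs_splitOff_of_not_adj (fun h => hzu (hA' u h)) h1.2 hzu]
            exact h1.1
      · have hpZ : p ∈ z :: l := List.mem_cons_of_mem _ hp
        by_cases hc : ∃ c, Gs.Adj p c ∧ c ∉ z :: l ∧ y ≠ c ∧ ¬ Gs.Adj y c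
        · obtain ⟨c, hpc, hcZ, hyc, hnyc⟩ := hc
          have st₁ := st.toPreClusterState.of_shortcut (z := z) (y := y) (p := p) (c := c)
            List.mem_cons_self hpZ hyZ hcZ hzy.symm hzp hpc hnyc hyc
          have hcz : c ≠ z := fun h => hcZ (h ▸ List.mem_cons_self)
          have hcl : c ∉ l := fun h => hcZ (List.mem_cons_of_mem _ h)
          have hyl : y ∉ l := fun h => hyZ (List.mem_cons_of_mem _ h)
          have hA₁ : (nbrs (shortcut Gs y z p c) z).filter (fun a => a ∉ l) = A.erase y := by
            ext a
            simp only [hAdef, Finset.mem_filter, mem_nbrs, shortcut_adj, Finset.mem_erase, ne_eq,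
              Sym2.eq_iff]
            grind
          have hm₁ : IsNonadjPairing (shortcut Gs y z p c) (A.erase y) m := by
            refine ⟨hm.mem, hm.invol, hm.ne, fun a ha h => ?_⟩
            rcases h with ⟨h, -⟩ | ⟨h, -⟩
            · exact hm.not_adj a ha h
            · rcases Sym2.eq_iff.1 h with ⟨h, -⟩ | ⟨-, h⟩
              · exact (Finset.mem_erase.1 ha).1 h
              · exact (Finset.mem_erase.1 (hm.mem a ha)).1 h
          rw [← hA₁] at hm₁
          have hpres : ∀ x ∈ l, ∀ w, w ≠ z → w ≠ y → w ≠ c → Gs.Adj x w →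
              (shortcut Gs y z p c).Adj x w := by
            intro x hx w h1 h2 h3 hxw
            have : x ≠ z := fun h => hzl (h ▸ hx)
            refine Or.inl ⟨hxw, ?_, ?_, ?_⟩ <;> rw [ne_eq, Sym2.eq_iff] <;> grind
          have st' := ClusterState.of_remove st₁ hm₁
            (st.attached.2.mono fun a ha b hb => hpres a ha b (fun h => hzl (h ▸ hb))
              (fun h => hyl (h ▸ hb)) fun h => hcl (h ▸ hb)) (by
              have := Finset.pred_card_le_card_erase (s := Ws) (a := c)
              omega) (fun x hx => by
              refine (Finset.card_le_card fun w => ?_).trans (herr x (List.mem_cons_of_mem _ hx))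
              simp only [mem_nonNbrs, Finset.mem_erase]
              rintro ⟨⟨hwc, hw⟩, hxw⟩
              refine ⟨hw, fun h => hxw ?_⟩
              have hwz : w ≠ z := fun h => (st.mem_Ws w hw).2.2 (h ▸ List.mem_cons_self)
              have hxz : x ≠ z := fun h => hzl (h ▸ hx)
              have hxc : x ≠ c := fun h => hcl (h ▸ hx)
              refine Or.inl ⟨h, ?_, ?_, ?_⟩ <;> rw [ne_eq, Sym2.eq_iff] <;> grind)
          have hcR := Finset.card_insert_of_notMem (s := R) hzR
          exact hG (ihk _ (by omega) st' rfl)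
        · -- `y` is adjacent to all outside neighbours of `p`, so it joins the cluster
          push Not at hc
          refine hext p {y} hpZ (Finset.singleton_nonempty _) ?_ ?_ ?_
          · rw [Finset.card_singleton]
            omega
          · intro b hb
            rw [Finset.mem_singleton.1 hb]
            exact ⟨hyZ, z, List.mem_cons_self, hzy.symm⟩
          · intro b hb
            rw [Finset.mem_singleton.1 hb]
            refine Finset.card_le_card fun w => ?_
            simp only [mem_nonNbrs, Finset.mem_filter, Finset.mem_singleton]
            rintro ⟨⟨hw, hpw⟩, hyw⟩
            by_contra hwy
            exact hyw (hc w hpw (st.mem_Ws w hw).2.2 (Ne.symm hwy))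
    · refine hext z B List.mem_cons_self hBne hBt (fun b hb => ⟨hAl b (hBA hb), z,
        List.mem_cons_self, (hA b (hBA hb)).symm⟩) fun b hb => ?_
      refine (Finset.card_le_card fun w => ?_).trans (hB b hb)
      simp only [mem_nonNbrs, Finset.mem_filter]
      rintro ⟨⟨hw, hzw⟩, hbw⟩
      exact ⟨hWA w hw hzw, hbw⟩

theorem NearlyMinDegree.hasCliqueImmersion (ht : 2 ≤ t) (h : NearlyMinDegree t G U) :
    HasCliqueImmersion t G := by
  induction U using Finset.strongInduction generalizing G with
  | H U ih =>
  obtain ⟨hsupp, v, hv, hdeg, hU⟩ := h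
  have hnon : nonNbrs G (nbrs G v) v = ∅ := by
    ext
    simp
  refine ClusterState.hasCliqueImmersion (Gs := G) (R := ∅) (Z := [v]) (Ws := nbrs G v)
    (idx := fun _ => 0) hU hv (fun G' U' hU' h' => ih U' hU' h') _ ⟨⟨ImmersesVia.refl G,
      fun a b h => ⟨hsupp a b h, Finset.notMem_empty _⟩, List.nodup_singleton _, by simp, by simp,
      fun a b _ _ _ _ h => h, fun _ _ _ => rfl, fun w hw => ?_, by simpa using (show 1 < t from ht), by simp,
      by simp, ?_⟩, ⟨Or.inl rfl, trivial⟩, by simp; omega, ?_⟩ rfl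
  · rw [mem_nbrs] at hw
    exact ⟨hsupp w v hw.symm, Finset.notMem_empty _, by simpa using hw.ne'⟩
  · simp [hnon]
  · simp [hnon]

end Removal

theorem theorem1p3 (t : ℕ) {V : Type*} [Fintype V] (G : SimpleGraph V) [DecidableRel G.Adj]
    (hG : 7 * t + 7 ≤ G.minDegree) :
    ContainsImmersion G (SimpleGraph.completeGraph (Fin t)) := by
  have hne : Nonempty V := by
    by_contra hV
    rw [not_nonempty_iff] at hV
    rw [SimpleGraph.minDegree_of_subsingleton] at hG
    omega
  obtain ⟨v⟩ := hne
  suffices h : HasCliqueImmersion t G by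
    obtain ⟨x, hx, h⟩ := h
    exact h.containsImmersion hx
  rcases Nat.lt_or_ge t 2 with ht | ht
  · refine hasCliqueImmersion_of_isClique (x := fun _ => v) (fun i j _ => ?_) (fun i j hij => ?_)
    · exact Fin.ext (by omega)
    · exact (hij (Fin.ext (by omega))).elim
  · have hdeg : ∀ u, 7 * t + 7 ≤ (nbrs G u).card := by
      intro u
      refine hG.trans ((G.minDegree_le_degree u).trans_eq ?_)
      rw [← SimpleGraph.card_neighborFinset_eq_degree]
      congr 1
      ext
      simp
    exact NearlyMinDegree.hasCliqueImmersion (U := Finset.univ) ht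
      ⟨by simp, v, Finset.mem_univ v, (Nat.le_succ _).trans (hdeg v), fun u _ _ => hdeg u⟩
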